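/- **Model.** For each $n$, let $V=\{1,\dots,n\}$ be partitioned into $\kappa$ communities by $c:V\to\{1,\dots,\kappa\}$, let $p_{ab}=p_{ba}\in(0,1)$ $(1\le a,b\le\kappa)$ be affinity values, and let $s_1,s_2\in(0,1)$; all of these may depend on $n$. The underlying network $G$ is the simple random graph on $V$ in which the pairs $\{u,v\}$ are edges independently with probability $p_{c(u)c(v)}$. Given $G$, the published network $G_1$ keeps each edge of $G$ with probability $s_1$, and, independently, a second sample keeps each edge with probability $s_2$ (all choices independent); the auxiliary network $G_2$ is the second sample with every node $u$ relabeled as $\pi_0(u)$. Here $\pi_0$, the correct mapping, belongs to the set $\Pi$ of bijections $\pi:V\to V$ with $c(\pi(i))=c(i)$ for all $i$. For $\pi\in\Pi$ let $$\Delta_\pi=\sum_{i\le j}w_{ij}\,\bigl|\mathbf 1\{(i,j)\in E(G_1)\}-\mathbf 1\{(\pi(i),\pi(j))\in E(G_2)\}\bigr|,\qquad w_{ij}=\log\frac{1-p_{c(i)c(j)}(s_1+s_2-s_1s_2)}{p_{c(i)c(j)}(1-s_1)(1-s_2)} .$$ Put $\alpha=\min_{a,b}p_{ab}$ and $\beta=\max_{a,b}p_{ab}$.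 **Corollary 4.1.** For every $\eta>0$ there are constants $c_1,K>0$, depending only on $\eta$, such that the following holds. Suppose that, for all large $n$, $\beta\le 1-\eta$ and $\frac{\log\alpha}{\log\beta}\le\gamma$ (where $\gamma$ may depend on $n$). Let $0\le\delta\le1$ be a real number and let $0\le\varepsilon=\varepsilon_n\le1$ satisfy, for all large $n$, $$\varepsilon\le c_1\Bigl(\delta-\frac{\delta^2}{2}\Bigr)\alpha(1-\beta)s_1s_2\log(1/\alpha).$$ Suppose further that $$\frac{\alpha(1-\beta)^2s_1^2s_2^2\log(1/\alpha)}{s_1+s_2}\quad\text{is}\quad\Omega\Bigl(\frac{\gamma\log^2n}{(1-\delta/2)\,n}\Bigr)\ \text{ and }\ \omega\Bigl(\frac1n\Bigr),$$ where the implied constant in $\Omega$ may be any positive number if $\delta>0$, and is at least $K$ if $\delta=0$. Then, with probability tending to $1$ as $n\to\infty$, every $\pi^*\in\Pi$ with $\Delta_{\pi^*}-\min_{\pi\in\Pi}\Delta_\pi\le\varepsilon n^2$ maps at least $(1-\delta)n$ nodes correctly, that is, $\pi^*(i)=\pi_0(i)$ for at least $(1-\delta)n$ nodes $i$. -/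

import Mathlib

open Filter Topology MeasureTheory ProbabilityTheory

namespace Deanon

/-- Parameters of the network model on the node set `Fin n`: communities, affinity values,
sampling probabilities, and the correct mapping, which observes the community assignment. -/
structure Model (n : ℕ) where
  /-- number of communities -/
  κ : ℕ
  /-- community assignment (of both published and auxiliary network) -/
  c : Fin n → Fin κ
  /-- affinity values -/
  p : Fin κ → Fin κ → ℝ
  p_symm : ∀ a b, p a b = p b a
  p_pos : ∀ a b, 0 < p a b
  p_lt_one : ∀ a b, p a b < 1
  /-- edge sampling probability of the published network -/
  s₁ : ℝ
  s₁_pos : 0 < s₁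
  s₁_lt_one : s₁ < 1
  /-- edge sampling probability of the auxiliary network -/
  s₂ : ℝ
  s₂_pos : 0 < s₂
  s₂_lt_one : s₂ < 1
  /-- the correct mapping from the published to the auxiliary network -/
  π₀ : Equiv.Perm (Fin n)
  π₀_comm : ∀ i, c i = c (π₀ i)

namespace Model

variable {n : ℕ} (M : Model n)

/-- The smallest affinity value. -/
noncomputable def α : ℝ := ⨅ ab : Fin M.κ × Fin M.κ, M.p ab.1 ab.2

/-- The largest affinity value. -/
noncomputable def β : ℝ := ⨆ ab : Fin M.κ × Fin M.κ, M.p ab.1 ab.2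

/-- Edge probability of an unordered pair of nodes in the underlying network. -/
def pairProb (e : Sym2 (Fin n)) : ℝ :=
  Sym2.lift ⟨fun u v => M.p (M.c u) (M.c v), fun _ _ => M.p_symm _ _⟩ e

theorem pairProb_mem (e : Sym2 (Fin n)) : M.pairProb e ∈ unitInterval := by
  induction e with
  | _ u v => exact ⟨(M.p_pos _ _).le, (M.p_lt_one _ _).le⟩

/-- Outcomes. For every unordered pair of nodes there are three coins: whether the pair is an edge
of the underlying network, and whether an edge there is kept in the first and in the second
sample. (Coins of the diagonal pairs are never used.) -/
abbrev Outcome (n : ℕ) : Type := Sym2 (Fin n) → Bool × Bool × Bool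

/-- The probability measure under which all the coins are independent, with success probabilities
`p_{c(u)c(v)}`, `s₁` and `s₂`. -/
noncomputable def law : Measure (Outcome n) :=
  Measure.pi fun e =>
    (bernoulliMeasure true false ⟨M.pairProb e, M.pairProb_mem e⟩).prod
      ((bernoulliMeasure true false ⟨M.s₁, M.s₁_pos.le, M.s₁_lt_one.le⟩).prod
        (bernoulliMeasure true false ⟨M.s₂, M.s₂_pos.le, M.s₂_lt_one.le⟩))

/-- The underlying network `G`. -/
def G (ω : Outcome n) : SimpleGraph (Fin n) where
  Adj u v := u ≠ v ∧ (ω s(u, v)).1 = true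
  symm := ⟨fun u v h => ⟨h.1.symm, by rw [Sym2.eq_swap]; exact h.2⟩⟩
  loopless := ⟨fun _ h => h.1 rfl⟩

/-- The published network `G₁`: a sample of `G`, with the same labels. -/
def G₁ (ω : Outcome n) : SimpleGraph (Fin n) where
  Adj u v := (G ω).Adj u v ∧ (ω s(u, v)).2.1 = true
  symm := ⟨fun u v h => ⟨h.1.symm, by rw [Sym2.eq_swap]; exact h.2⟩⟩
  loopless := ⟨fun _ h => h.1.1 rfl⟩

/-- The second sample of `G`, before its nodes are relabeled. -/
def sample₂ (ω : Outcome n) : SimpleGraph (Fin n) where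
  Adj u v := (G ω).Adj u v ∧ (ω s(u, v)).2.2 = true
  symm := ⟨fun u v h => ⟨h.1.symm, by rw [Sym2.eq_swap]; exact h.2⟩⟩
  loopless := ⟨fun _ h => h.1.1 rfl⟩

/-- The auxiliary network `G₂`: node `u` of the second sample gets the label `π₀ u`. -/
def G₂ (ω : Outcome n) : SimpleGraph (Fin n) := (sample₂ ω).comap M.π₀.symm

/-- The weight of a pair of nodes in the cost function. -/
noncomputable def w (i j : Fin n) : ℝ :=
  Real.log ((1 - M.p (M.c i) (M.c j) * (M.s₁ + M.s₂ - M.s₁ * M.s₂)) /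
    (M.p (M.c i) (M.c j) * (1 - M.s₁) * (1 - M.s₂)))

open Classical in
/-- The cost function of a mapping: its weighted number of edge disagreements. -/
noncomputable def cost (ω : Outcome n) (π : Equiv.Perm (Fin n)) : ℝ :=
  ∑ ij : Fin n × Fin n with ij.1 ≤ ij.2,
    M.w ij.1 ij.2 * |(if (G₁ ω).Adj ij.1 ij.2 then (1 : ℝ) else 0) -
      (if (M.G₂ ω).Adj (π ij.1) (π ij.2) then (1 : ℝ) else 0)|

/-- The set `Π` of the mappings that observe the community assignment. -/
def mappings : Set (Equiv.Perm (Fin n)) := {π | ∀ i, M.c i = M.c (π i)}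

/-- The minimum of the cost over the mappings in `Π` (a finite set that contains `π₀`). -/
noncomputable def minCost (ω : Outcome n) : ℝ := ⨅ π : M.mappings, M.cost ω π

/-- The number of nodes that a mapping maps correctly. -/
def numCorrect (π : Equiv.Perm (Fin n)) : ℕ := (Finset.univ.filter fun i => π i = M.π₀ i).card

/-- The event that every mapping in `Π` whose cost is within `t` of the minimum maps at least `m`
nodes correctly. -/
def accurate (t m : ℝ) : Set (Outcome n) :=
  {ω | ∀ π ∈ M.mappings, M.cost ω π - M.minCost ω ≤ t → m ≤ M.numCorrect π}

/-- The quantity on which the density condition is imposed. -/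
noncomputable def density : ℝ :=
  M.α * (1 - M.β) ^ 2 * M.s₁ ^ 2 * M.s₂ ^ 2 * Real.log (1 / M.α) / (M.s₁ + M.s₂)

end Model

end Deanon

/-! Put `σ = π₀⁻¹ * π` and let `S` be its support. For indicators `|a - b| = a + b - 2ab`, and
relabeling inside communities preserves the weights, so the linear terms cancel. The excess cost of
`π` over `π₀` is `2 (Y - Z)`: here `Y` is the weight of the pairs meeting `S` that survive in both
samples, and `Z` that of the pairs `e` meeting `S` with `e` in the first and `σ e` in the second
sample (`cost_sub_cost`). A pair contributes `w p s₁ s₂` to the mean of `Y`, but only `w p² s₁ s₂`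
to that of `Z` unless `σ` fixes it, and at most `|S|` of these pairs are fixed. Since `p ≤ 1 - η`,
this leaves a gap of order `η * meanWeight S`, which exceeds `ε n²` once `|S| > δ n`
(`mem_accurate`).

Concentration of `Z` has to cope with dependent summands. Each coordinate enters at most two of
them, so Finner's inequality bounds exponential moments as under independence, with doubled
exponents (`lintegral_exp_sum_le`). The upper tail of `Z` is at most `exp (|S| (1 - v))` with `v` of
order `n α s₁ s₂ log (1 / β)`. The density condition makes `v` at least a multiple of `log² n`,
which beats the at most `n ^ |S|` permutations with support `S` and the choice of `S`.

`Y` depends on `σ` only through `S`, so its union bound runs over sets alone. There a failure bound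
`exp (-u |S|)` with `u` a multiple of `log n` suffices: any multiple if `δ > 0`, a large one if `δ =
0` and small sets count. -/

namespace Deanon

/-! ### Exponential moments of sums of indicators of two coordinates each -/

section Concentration

open scoped ENNReal
open Function (update)

variable {ι X : Type*} [Fintype ι] [DecidableEq ι] [MeasurableSpace X]

/-- Hölder's inequality for a product of square roots at most two of which are not constant. -/
theorem lintegral_prod_rpow_half_le (ν : Measure X) [IsProbabilityMeasure ν] (h : ι → X → ℝ≥0∞)
    (hm : ∀ e, Measurable (h e)) (a b : ι)
    (hc : ∀ e, e ≠ a → e ≠ b → ∀ x y, h e x = h e y) :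
    ∫⁻ x, ∏ e, h e x ^ (1 / 2 : ℝ) ∂ν ≤ ∏ e, (∫⁻ x, h e x ∂ν) ^ (1 / 2 : ℝ) := by
  obtain ⟨x₀⟩ : Nonempty X := nonempty_of_isProbabilityMeasure ν
  have hsplit : ∀ f : ι → ℝ≥0∞, ∏ e, f e = (∏ e ∈ ({a, b} : Finset ι)ᶜ, f e) *
      ∏ e ∈ ({a, b} : Finset ι), f e := fun f => (Finset.prod_compl_mul_prod _ _).symm
  have hconst : ∀ e ∈ ({a, b} : Finset ι)ᶜ, ∀ x, h e x = h e x₀ := fun e he x => by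
    simp only [Finset.mem_compl, Finset.mem_insert, Finset.mem_singleton, not_or] at he
    exact hc e he.1 he.2 x x₀
  have h1 : ∀ x, ∏ e, h e x ^ (1 / 2 : ℝ) =
      (∏ e ∈ ({a, b} : Finset ι)ᶜ, h e x₀ ^ (1 / 2 : ℝ)) *
        ∏ e ∈ ({a, b} : Finset ι), h e x ^ (1 / 2 : ℝ) := fun x => by
    rw [hsplit]
    congr 1
    exact Finset.prod_congr rfl fun e he => by rw [hconst e he x]
  have h2 : ∏ e ∈ ({a, b} : Finset ι)ᶜ, (∫⁻ x, h e x ∂ν) ^ (1 / 2 : ℝ) =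
      ∏ e ∈ ({a, b} : Finset ι)ᶜ, h e x₀ ^ (1 / 2 : ℝ) :=
    Finset.prod_congr rfl fun e he => by
      rw [lintegral_congr (hconst e he), lintegral_const, measure_univ, mul_one]
  simp_rw [h1]
  rw [hsplit, h2, lintegral_const_mul _ (by fun_prop)]
  gcongr
  have hcard : (({a, b} : Finset ι).card : ℝ) ≤ 2 := by exact_mod_cast Finset.card_le_two
  -- The constant `g = 1` absorbs the exponent left over, `1 / 2` if `a = b` and `0` otherwise.
  have := ENNReal.lintegral_mul_prod_norm_pow_le (μ := ν) ({a, b} : Finset ι) (g := fun _ => 1)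
    (f := h) aemeasurable_const (fun e _ => (hm e).aemeasurable)
    (1 - ({a, b} : Finset ι).card / 2) (p := fun _ => 1 / 2) (by simp; ring) (by linarith)
    (fun _ _ => by norm_num)
  simpa using this

/-- Finner's inequality, for functions `G e` of the two coordinates `e` and `τ e`. -/
theorem lmarginal_prod_rpow_half_le (μ : ι → Measure X) [∀ i, IsProbabilityMeasure (μ i)]
    (τ : Equiv.Perm ι) (G : ι → (ι → X) → ℝ≥0∞) (hG : ∀ e, Measurable (G e))
    (hdep : ∀ e i, i ≠ e → i ≠ τ e → ∀ x y, G e (update x i y) = G e x)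
    (s : Finset ι) (x : ι → X) :
    (∫⋯∫⁻_s, fun ω => ∏ e, G e ω ^ (1 / 2 : ℝ) ∂μ) x ≤
      ∏ e, ((∫⋯∫⁻_s, G e ∂μ) x) ^ (1 / 2 : ℝ) := by
  induction s using Finset.induction_on generalizing x with
  | empty => simp
  | insert i s hi ih =>
    rw [lmarginal_insert _ (by fun_prop) hi]
    have hm : ∀ e, Measurable fun y => (∫⋯∫⁻_s, G e ∂μ) (update x i y) := fun e =>
      ((hG e).lmarginal μ).comp (measurable_update x)
    calc _ ≤ ∫⁻ y, ∏ e, ((∫⋯∫⁻_s, G e ∂μ) (update x i y)) ^ (1 / 2 : ℝ) ∂μ i :=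
          lintegral_mono fun y => ih _
      _ ≤ ∏ e, (∫⁻ y, (∫⋯∫⁻_s, G e ∂μ) (update x i y) ∂μ i) ^ (1 / 2 : ℝ) := by
          -- Coordinate `i` enters only the factors with index `i` and `τ.symm i`.
          refine lintegral_prod_rpow_half_le (μ i) _ hm i (τ.symm i) fun e h1 h2 y z => ?_
          have : ∀ y, (∫⋯∫⁻_s, G e ∂μ) (update x i y) = (∫⋯∫⁻_s, G e ∂μ) x := fun y => by
            rw [lmarginal_update_of_notMem (hG e) hi]
            congr 1
            funext ω
            exact hdep e i (Ne.symm h1) (fun h => h2 (by simp [h])) ω y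
          rw [this, this]
      _ = _ := by
          refine Finset.prod_congr rfl fun e _ => ?_
          rw [lmarginal_insert _ (hG e) hi]

/-- An exponential moment bound for a weighted sum of indicators, each of which depends on two
coordinates. -/
theorem lintegral_exp_sum_le (μ : ι → Measure X) [∀ i, IsProbabilityMeasure (μ i)]
    (τ : Equiv.Perm ι) (C : ι → Set (ι → X)) (hC : ∀ e, MeasurableSet (C e))
    (hdep : ∀ e i, i ≠ e → i ≠ τ e → ∀ x y, update x i y ∈ C e ↔ x ∈ C e) (t : ι → ℝ) :
    ∫⁻ ω, ENNReal.ofReal (Real.exp (∑ e, t e * (C e).indicator 1 ω)) ∂Measure.pi μ ≤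
      ENNReal.ofReal (Real.exp
        (∑ e, (Measure.pi μ).real (C e) * (Real.exp (2 * t e) - 1) / 2)) := by
  classical
  obtain ⟨x₀⟩ : Nonempty (ι → X) := nonempty_of_isProbabilityMeasure (Measure.pi μ)
  set G : ι → (ι → X) → ℝ≥0∞ := fun e ω =>
    ENNReal.ofReal (Real.exp (2 * t e * (C e).indicator 1 ω)) with hGdef
  have hG : ∀ e, Measurable (G e) := fun e => by
    have : Measurable ((C e).indicator (1 : (ι → X) → ℝ)) := measurable_one.indicator (hC e)
    fun_prop
  have hGd : ∀ e i, i ≠ e → i ≠ τ e → ∀ x y, G e (update x i y) = G e x := by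
    intro e i h1 h2 x y
    simp only [hGdef, Set.indicator_apply, hdep e i h1 h2 x y, Pi.one_apply]
  have hint : ∀ e, ∫⁻ ω, G e ω ∂Measure.pi μ ≤
      ENNReal.ofReal (Real.exp ((Measure.pi μ).real (C e) * (Real.exp (2 * t e) - 1))) := by
    intro e
    have hi : Integrable ((C e).indicator (1 : (ι → X) → ℝ)) (Measure.pi μ) :=
      (integrable_const (1 : ℝ)).indicator (hC e)
    have h1 : ∀ ω, Real.exp (2 * t e * (C e).indicator 1 ω) =
        1 + (Real.exp (2 * t e) - 1) * (C e).indicator 1 ω := fun ω => by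
      by_cases h : ω ∈ C e <;> simp [h]
    simp only [hGdef, h1]
    rw [← ofReal_integral_eq_lintegral_ofReal]
    · refine ENNReal.ofReal_le_ofReal ?_
      rw [integral_add (integrable_const _) (hi.const_mul _), integral_const_mul,
        integral_indicator_one (hC e)]
      simp only [integral_const, probReal_univ, smul_eq_mul, mul_one]
      linarith [Real.add_one_le_exp ((Measure.pi μ).real (C e) * (Real.exp (2 * t e) - 1))]
    · exact (integrable_const _).add (hi.const_mul _)
    · exact Eventually.of_forall fun ω => by
        simp only [Pi.zero_apply, ← h1]; positivity
  calc _ = ∫⁻ ω, ∏ e, G e ω ^ (1 / 2 : ℝ) ∂Measure.pi μ := by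
        refine lintegral_congr fun ω => ?_
        rw [Real.exp_sum, ENNReal.ofReal_prod_of_nonneg fun _ _ => (Real.exp_pos _).le]
        refine Finset.prod_congr rfl fun e _ => ?_
        simp only [hGdef]
        rw [ENNReal.ofReal_rpow_of_pos (Real.exp_pos _), ← Real.exp_mul]
        congr 2
        ring
    _ ≤ ∏ e, (∫⁻ ω, G e ω ∂Measure.pi μ) ^ (1 / 2 : ℝ) := by
        have := lmarginal_prod_rpow_half_le μ τ G hG hGd Finset.univ x₀
        simpa only [lmarginal_univ] using this
    _ ≤ ∏ e, ENNReal.ofReal (Real.exp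
          ((Measure.pi μ).real (C e) * (Real.exp (2 * t e) - 1))) ^ (1 / 2 : ℝ) := by
        gcongr with e
        exact hint e
    _ = _ := by
        rw [Real.exp_sum, ENNReal.ofReal_prod_of_nonneg fun _ _ => (Real.exp_pos _).le]
        refine Finset.prod_congr rfl fun e _ => ?_
        rw [ENNReal.ofReal_rpow_of_pos (Real.exp_pos _), ← Real.exp_mul]
        congr 2
        ring

/-- The Chernoff bound for a weighted sum of indicators, each of which depends on two
coordinates. -/
theorem measureReal_le_sum_indicator (μ : ι → Measure X) [∀ i, IsProbabilityMeasure (μ i)]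
    (τ : Equiv.Perm ι) (C : ι → Set (ι → X)) (hC : ∀ e, MeasurableSet (C e))
    (hdep : ∀ e i, i ≠ e → i ≠ τ e → ∀ x y, update x i y ∈ C e ↔ x ∈ C e) (t : ι → ℝ) (a : ℝ) :
    (Measure.pi μ).real {ω | a ≤ ∑ e, t e * (C e).indicator 1 ω} ≤
      Real.exp (∑ e, (Measure.pi μ).real (C e) * (Real.exp (2 * t e) - 1) / 2 - a) := by
  have hm : ∀ e, Measurable ((C e).indicator (1 : (ι → X) → ℝ)) := fun e =>
    measurable_one.indicator (hC e)
  have h := mul_meas_ge_le_lintegral (μ := Measure.pi μ)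
    (f := fun ω => ENNReal.ofReal (Real.exp (∑ e, t e * (C e).indicator 1 ω)))
    (by fun_prop) (ENNReal.ofReal (Real.exp a))
  have hset : {ω | ENNReal.ofReal (Real.exp a) ≤
      ENNReal.ofReal (Real.exp (∑ e, t e * (C e).indicator 1 ω))} =
      {ω | a ≤ ∑ e, t e * (C e).indicator 1 ω} := by
    ext ω
    simp only [Set.mem_ofPred_eq]
    rw [ENNReal.ofReal_le_ofReal_iff (Real.exp_pos _).le, Real.exp_le_exp]
  rw [hset] at h
  have h2 := ENNReal.toReal_mono ENNReal.ofReal_ne_top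
    (h.trans (lintegral_exp_sum_le μ τ C hC hdep t))
  rw [ENNReal.toReal_mul, ENNReal.toReal_ofReal (Real.exp_pos _).le,
    ENNReal.toReal_ofReal (Real.exp_pos _).le] at h2
  rw [Real.exp_sub, le_div_iff₀ (Real.exp_pos _), mul_comm]
  exact h2

end Concentration

/-! ### Analytic estimates for the weights -/

section Weight

/-- The weight of a pair with affinity value `p`, where `q = (1 - s₁) * (1 - s₂)`. -/
noncomputable def weight (q p : ℝ) : ℝ := Real.log (1 + (1 / p - 1) / q)

variable {q a p η : ℝ}

theorem one_le_one_add_div (hq : 0 < q) (hp : 0 < p) (hp1 : p < 1) :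
    1 < 1 + (1 / p - 1) / q := by
  have : 1 < 1 / p := by rw [lt_div_iff₀ hp]; linarith
  have : 0 < (1 / p - 1) / q := div_pos (by linarith) hq
  linarith

theorem weight_pos (hq : 0 < q) (hp : 0 < p) (hp1 : p < 1) : 0 < weight q p :=
  Real.log_pos (one_le_one_add_div hq hp hp1)

theorem log_one_div_pos (hp : 0 < p) (hp1 : p < 1) : 0 < Real.log (1 / p) :=
  Real.log_pos (by rw [lt_div_iff₀ hp]; linarith)

theorem weight_anti (hq : 0 < q) (ha : 0 < a) (hap : a ≤ p) (hp1 : p < 1) :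
    weight q p ≤ weight q a := by
  have hp : 0 < p := ha.trans_le hap
  refine Real.log_le_log (by linarith [one_le_one_add_div hq hp hp1]) ?_
  gcongr

theorem log_one_div_le_weight (hq : 0 < q) (hq1 : q ≤ 1) (hp : 0 < p) (hp1 : p < 1) :
    Real.log (1 / p) ≤ weight q p := by
  refine Real.log_le_log (by positivity) ?_
  have : 1 < 1 / p := by rw [lt_div_iff₀ hp]; linarith
  have : 1 / p - 1 ≤ (1 / p - 1) / q := by
    rw [le_div_iff₀ hq]
    nlinarith
  linarith

/-- The quotient `weight q p / log (1 / p)` is increasing in `p`. -/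
theorem log_mul_weight_le (hq : 0 < q) (hq1 : q ≤ 1) (ha : 0 < a) (hap : a ≤ p) (hp1 : p < 1) :
    Real.log (1 / p) * weight q a ≤ Real.log (1 / a) * weight q p := by
  have hp : 0 < p := ha.trans_le hap
  have ha1 : a < 1 := hap.trans_lt hp1
  have hLa := log_one_div_pos ha ha1
  have hLp := log_one_div_pos hp hp1
  set l := Real.log (1 / p) / Real.log (1 / a) with hl
  have hl0 : 0 ≤ l := (div_pos hLp hLa).le
  have hl1 : l ≤ 1 := by
    rw [hl, div_le_one hLa]
    exact Real.log_le_log (by positivity) (by gcongr)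
  have hpow : (1 / a) ^ l = 1 / p := by
    rw [Real.rpow_def_of_pos (by positivity), hl, mul_div_cancel₀ _ hLa.ne',
      Real.exp_log (by positivity)]
  have hA := one_le_one_add_div hq ha ha1
  -- Concavity of `x ↦ x ^ l` at `1 / a`, which is the average of `1` and of the argument of the
  -- logarithm in `weight q a`, taken with weights `1 - q` and `q`.
  have hconc := (Real.concaveOn_rpow hl0 hl1).2 (Set.mem_Ici.2 zero_le_one)
    (Set.mem_Ici.2 (zero_le_one.trans hA.le)) (sub_nonneg.2 hq1) hq.le (sub_add_cancel 1 q)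
  have hcomb : (1 - q) * 1 + q * (1 + (1 / a - 1) / q) = 1 / a := by
    field_simp
    ring
  simp only [smul_eq_mul, Real.one_rpow] at hconc
  rw [hcomb, hpow] at hconc
  have hle : (1 + (1 / a - 1) / q) ^ l ≤ 1 + (1 / p - 1) / q := by
    have : (1 / p - 1) / q * q = 1 / p - 1 := div_mul_cancel₀ _ hq.ne'
    by_contra! h
    nlinarith
  have hlog := Real.log_le_log (Real.rpow_pos_of_pos (by linarith) _) hle
  rw [Real.log_rpow (by linarith)] at hlog
  change l * weight q a ≤ weight q p at hlog
  calc Real.log (1 / p) * weight q a = Real.log (1 / a) * (l * weight q a) := by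
        rw [hl]; field_simp
    _ ≤ _ := by gcongr

/-- `x log (1 / x)` is not monotone, but it is concave and vanishes at `1`. Hence its value at `p`
is at least `(1 - p) / (1 - a) ≥ η` times its value at `a`. -/
theorem mul_log_one_div_ge (ha : 0 < a) (hap : a ≤ p) (hpη : p ≤ 1 - η) (hη : 0 < η) :
    η * (a * Real.log (1 / a)) ≤ p * Real.log (1 / p) := by
  have hp : 0 < p := ha.trans_le hap
  have ha1 : a < 1 := by linarith
  have hL := log_one_div_pos ha ha1
  set l := (1 - p) / (1 - a)
  have hl : l * (1 - a) = 1 - p := div_mul_cancel₀ _ (by linarith)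
  have hl0 : 0 ≤ l := div_nonneg (by linarith) (by linarith)
  have hl1 : l ≤ 1 := (div_le_one (by linarith)).2 (by linarith)
  have hη' : η ≤ l := (show η ≤ 1 - p by linarith).trans
    (le_div_self (by linarith) (by linarith) (by linarith))
  have hconc := Real.concaveOn_negMulLog.2 (Set.mem_Ici.2 ha.le) (Set.mem_Ici.2 zero_le_one)
    hl0 (sub_nonneg.2 hl1) (add_sub_cancel l 1)
  have hcomb : l * a + (1 - l) * 1 = p := by linarith
  simp only [smul_eq_mul, hcomb, Real.negMulLog_one, mul_zero, add_zero] at hconc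
  rw [Real.negMulLog, Real.negMulLog] at hconc
  rw [one_div, one_div, Real.log_inv, Real.log_inv] at *
  have : 0 ≤ a * -Real.log a := by positivity
  nlinarith

theorem mul_weight_ge (hq : 0 < q) (hq1 : q ≤ 1) (ha : 0 < a) (hap : a ≤ p) (hpη : p ≤ 1 - η)
    (hη : 0 < η) : η * (a * weight q a) ≤ p * weight q p := by
  have hp : 0 < p := ha.trans_le hap
  have hL := log_one_div_pos ha (by linarith : a < 1)
  have hw := weight_pos hq ha (by linarith : a < 1)
  refine le_of_mul_le_mul_right ?_ hL
  calc η * (a * weight q a) * Real.log (1 / a)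
      = η * (a * Real.log (1 / a)) * weight q a := by ring
    _ ≤ p * Real.log (1 / p) * weight q a :=
        mul_le_mul_of_nonneg_right (mul_log_one_div_ge ha hap hpη hη) hw.le
    _ = p * (Real.log (1 / p) * weight q a) := by ring
    _ ≤ p * (Real.log (1 / a) * weight q p) :=
        mul_le_mul_of_nonneg_left (log_mul_weight_le hq hq1 ha hap (by linarith)) hp.le
    _ = _ := by ring

/-- The exponential moment estimate for a true coincidence of edges, lower tail. -/
theorem exp_neg_sub_one_le {x : ℝ} (hx : 0 ≤ x) (hxη : x ≤ η / 16) (hη1 : η ≤ 1) :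
    (Real.exp (2 * -x) - 1) / 2 ≤ -(x * (1 - η / 8)) := by
  have h1 : Real.exp (2 * -x) ≤ 1 - 2 * x + 4 * x ^ 2 := by
    have := Real.abs_exp_sub_one_sub_id_le (x := 2 * -x) (by rw [abs_le]; constructor <;> linarith)
    have := (abs_le.1 this).2
    nlinarith
  nlinarith

/-- The exponential moment estimate for a false coincidence of edges, upper tail. -/
theorem mul_exp_sub_one_le {x : ℝ} (hp : 0 < p) (hpη : p ≤ 1 - η) (hx : 0 ≤ x)
    (hx1 : x ≤ Real.log (1 / p) / 16) (hη : 0 < η) :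
    p * ((Real.exp (2 * x) - 1) / 2) ≤ x * (1 - 7 * η / 8) := by
  have h1 : Real.exp (2 * x) - 1 ≤ 2 * x * Real.exp (2 * x) := by
    have := Real.add_one_le_exp (-(2 * x))
    have h2 : Real.exp (-(2 * x)) * Real.exp (2 * x) = 1 := by rw [← Real.exp_add]; simp
    nlinarith [Real.exp_pos (2 * x)]
  -- The exponential costs at most an eighth of the power of `p`, so that `p ^ (7 / 8)` remains;
  -- Bernoulli's inequality then makes the bound linear in `η`.
  have h2 : p * Real.exp (2 * x) ≤ (1 - η) ^ (7 / 8 : ℝ) := by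
    calc p * Real.exp (2 * x) ≤ p * Real.exp (Real.log (1 / p) / 8) := by
          gcongr; linarith
      _ = p ^ (7 / 8 : ℝ) := by
          rw [Real.rpow_def_of_pos hp]
          nth_rewrite 1 [← Real.exp_log hp]
          rw [← Real.exp_add, one_div, Real.log_inv]
          congr 1
          ring
      _ ≤ _ := Real.rpow_le_rpow hp.le hpη (by norm_num)
  have h3 : (1 - η) ^ (7 / 8 : ℝ) ≤ 1 - 7 * η / 8 := by
    have := rpow_one_add_le_one_add_mul_self (s := -η) (by linarith) (p := 7 / 8) (by norm_num)
      (by norm_num)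
    rw [← sub_eq_add_neg] at this
    linarith
  nlinarith

/-- Used for the pairs fixed by `σ`, which lack the second factor `p`. They are so few that a bound
of `1` for each is enough. -/
theorem mul_exp_sub_one_le_one {x : ℝ} (hp : 0 < p) (hp1 : p < 1) (hx : 0 ≤ x)
    (hx1 : x ≤ Real.log (1 / p) / 16) :
    p * ((Real.exp (2 * x) - 1) / 2) ≤ 1 := by
  have h2 : p * Real.exp (2 * x) ≤ 1 := by
    calc p * Real.exp (2 * x) ≤ p * Real.exp (Real.log (1 / p)) := by
          gcongr; linarith [log_one_div_pos hp hp1]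
      _ = 1 := by rw [Real.exp_log (by positivity)]; field_simp
  linarith

end Weight

/-! ### Unordered pairs that meet the support of a permutation -/

section Pairs

variable {n : ℕ}

/-- The action of a permutation of the nodes on the unordered pairs of nodes. -/
def pairPerm (σ : Equiv.Perm (Fin n)) : Equiv.Perm (Sym2 (Fin n)) where
  toFun := Sym2.map σ
  invFun := Sym2.map σ.symm
  left_inv e := by rw [Sym2.map_map]; simp
  right_inv e := by rw [Sym2.map_map]; simp

theorem pairPerm_mk (σ : Equiv.Perm (Fin n)) (u v : Fin n) :
    pairPerm σ s(u, v) = s(σ u, σ v) := rfl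

theorem pairPerm_one : pairPerm (1 : Equiv.Perm (Fin n)) = 1 := by
  ext e
  induction e with
  | _ u v => rfl

open Classical in
/-- The pairs of distinct nodes that meet `S`. -/
noncomputable def pairsMeeting (S : Finset (Fin n)) : Finset (Sym2 (Fin n)) :=
  Finset.univ.filter fun e => ¬e.IsDiag ∧ ∃ v ∈ e, v ∈ S

theorem mem_pairsMeeting {S : Finset (Fin n)} {e : Sym2 (Fin n)} :
    e ∈ pairsMeeting S ↔ ¬e.IsDiag ∧ ∃ v ∈ e, v ∈ S := by
  simp [pairsMeeting]

/-- Double counting: among the ordered pairs of distinct nodes with first entry in `S`, at most two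
give the same unordered pair. -/
theorem card_mul_le_card_pairsMeeting (S : Finset (Fin n)) :
    S.card * (n - 1) ≤ 2 * (pairsMeeting S).card := by
  classical
  set P : Finset (Fin n × Fin n) := S.biUnion fun v => (Finset.univ.erase v).image fun u => (v, u)
  have hP : P.card = S.card * (n - 1) := by
    rw [Finset.card_biUnion]
    · rw [Finset.sum_const_nat (m := n - 1)]
      intro v _
      rw [Finset.card_image_of_injective _ (fun a b h => (Prod.ext_iff.1 h).2)]
      simp
    · intro v _ w _ hvw
      rw [Function.onFun, Finset.disjoint_left]
      intro x hx hx'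
      simp only [Finset.mem_image, Finset.mem_erase] at hx hx'
      obtain ⟨a, -, rfl⟩ := hx
      obtain ⟨b, -, h⟩ := hx'
      exact hvw (Prod.ext_iff.1 h).1.symm
  have himg : P.image (fun x => s(x.1, x.2)) ⊆ pairsMeeting S := by
    intro e he
    simp only [P, Finset.mem_image, Finset.mem_biUnion, Finset.mem_erase] at he
    obtain ⟨x, ⟨v, hv, u, hu, rfl⟩, rfl⟩ := he
    rw [mem_pairsMeeting]
    exact ⟨fun h => hu.1 (Sym2.mk_isDiag_iff.1 h).symm, v, Sym2.mem_mk_left _ _, hv⟩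
  rw [← hP]
  refine (Finset.card_le_mul_card_image (f := fun x : Fin n × Fin n => s(x.1, x.2)) P 2 ?_).trans
    (Nat.mul_le_mul_left 2 (Finset.card_le_card himg))
  intro e _
  induction e with
  | _ a b =>
    refine (Finset.card_le_card (t := {(a, b), (b, a)}) ?_).trans Finset.card_le_two
    rintro ⟨u, v⟩ h
    simpa using (Finset.mem_filter.1 h).2

theorem pairPerm_eq_self_of_notMem {σ : Equiv.Perm (Fin n)} {e : Sym2 (Fin n)}
    (hd : ¬e.IsDiag) (he : e ∉ pairsMeeting σ.support) : pairPerm σ e = e := by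
  rw [mem_pairsMeeting] at he
  push Not at he
  have he := he hd
  induction e with
  | _ u v =>
    have h1 := he u (Sym2.mem_mk_left _ _)
    have h2 := he v (Sym2.mem_mk_right _ _)
    rw [Equiv.Perm.notMem_support] at h1 h2
    rw [pairPerm_mk, h1, h2]

/-- A fixed pair that contains a moved node `v` must be swapped, so it is `s(v, σ v)`. -/
theorem card_fixed_pairs_le (σ : Equiv.Perm (Fin n)) :
    ((pairsMeeting σ.support).filter fun e => pairPerm σ e = e).card ≤ σ.support.card := by
  classical
  refine (Finset.card_le_card (t := σ.support.image fun u => s(u, σ u)) ?_).trans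
    Finset.card_image_le
  intro e he
  rw [Finset.mem_filter, mem_pairsMeeting] at he
  obtain ⟨⟨-, v, hv, hvS⟩, hfix⟩ := he
  obtain ⟨u, rfl⟩ := hv
  rw [Finset.mem_image]
  refine ⟨v, hvS, ?_⟩
  rw [pairPerm_mk, Sym2.eq_iff] at hfix
  rw [Equiv.Perm.mem_support] at hvS
  rcases hfix with h | h
  · exact absurd h.1 hvS
  · rw [h.1]

end Pairs

/-! ### The excess cost as a difference of coincidence weights -/

namespace Model

variable {n : ℕ} (M : Model n)

/-- The weight of an unordered pair of nodes. -/
noncomputable def pairWeight (e : Sym2 (Fin n)) : ℝ :=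
  weight ((1 - M.s₁) * (1 - M.s₂)) (M.pairProb e)

theorem one_sub_mul_pos : 0 < (1 - M.s₁) * (1 - M.s₂) :=
  mul_pos (sub_pos.2 M.s₁_lt_one) (sub_pos.2 M.s₂_lt_one)

theorem one_sub_mul_le_one : (1 - M.s₁) * (1 - M.s₂) ≤ 1 :=
  mul_le_one₀ (by linarith [M.s₁_pos]) (by linarith [M.s₂_lt_one]) (by linarith [M.s₂_pos])

theorem pairProb_pos (e : Sym2 (Fin n)) : 0 < M.pairProb e := by
  induction e with
  | _ u v => exact M.p_pos _ _

theorem pairProb_lt_one (e : Sym2 (Fin n)) : M.pairProb e < 1 := by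
  induction e with
  | _ u v => exact M.p_lt_one _ _

theorem pairWeight_pos (e : Sym2 (Fin n)) : 0 < M.pairWeight e :=
  weight_pos M.one_sub_mul_pos (M.pairProb_pos e) (M.pairProb_lt_one e)

theorem w_eq_pairWeight (i j : Fin n) : M.w i j = M.pairWeight s(i, j) := by
  have h1 : (1 - M.s₁) ≠ 0 := (sub_pos.2 M.s₁_lt_one).ne'
  have h2 : (1 - M.s₂) ≠ 0 := (sub_pos.2 M.s₂_lt_one).ne'
  have hp := (M.p_pos (M.c i) (M.c j)).ne'
  change Real.log _ = Real.log (1 + (1 / M.p (M.c i) (M.c j) - 1) / _)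
  congr 1
  field_simp
  ring

theorem pairProb_pairPerm {σ : Equiv.Perm (Fin n)} (hσ : ∀ i, M.c (σ i) = M.c i)
    (e : Sym2 (Fin n)) : M.pairProb (pairPerm σ e) = M.pairProb e := by
  induction e with
  | _ u v =>
    change M.p (M.c (σ u)) (M.c (σ v)) = M.p (M.c u) (M.c v)
    rw [hσ, hσ]

/-- The event that `e` is an edge of the first and `σ e` an edge of the second sample. -/
def coincidence (σ : Equiv.Perm (Fin n)) (e : Sym2 (Fin n)) : Set (Outcome n) :=
  {ω | ((ω e).1 = true ∧ (ω e).2.1 = true) ∧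
    ((ω (pairPerm σ e)).1 = true ∧ (ω (pairPerm σ e)).2.2 = true)}

/-- The total weight of the coincidences at the pairs that meet `S`. -/
noncomputable def coincidenceWeight (S : Finset (Fin n)) (σ : Equiv.Perm (Fin n))
    (ω : Outcome n) : ℝ :=
  ∑ e ∈ pairsMeeting S, M.pairWeight e * (coincidence σ e).indicator 1 ω

/-- The expected total weight of the true coincidences at the pairs that meet `S`. -/
noncomputable def meanWeight (S : Finset (Fin n)) : ℝ :=
  ∑ e ∈ pairsMeeting S, M.pairWeight e * (M.pairProb e * M.s₁ * M.s₂)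

open Classical in
theorem cost_eq_sum_sym2 (ω : Outcome n) (π : Equiv.Perm (Fin n)) :
    M.cost ω π = ∑ e, M.pairWeight e * |(if e ∈ (G₁ ω).edgeSet then (1 : ℝ) else 0) -
      (if pairPerm (M.π₀⁻¹ * π) e ∈ (sample₂ ω).edgeSet then (1 : ℝ) else 0)| := by
  rw [cost, ← Equiv.sum_comp Sym2.sortEquiv.symm, Finset.sum_subtype (p := fun ij => ij.1 ≤ ij.2)]
  · refine Finset.sum_congr rfl fun ij _ => ?_
    obtain ⟨⟨i, j⟩, h⟩ := ij
    rw [w_eq_pairWeight]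
    rfl
  · simp

open Classical in
theorem cost_sub_cost (ω : Outcome n) {π : Equiv.Perm (Fin n)} (hπ : π ∈ M.mappings) :
    M.cost ω π - M.cost ω M.π₀ =
      2 * (M.coincidenceWeight (M.π₀⁻¹ * π).support 1 ω -
        M.coincidenceWeight (M.π₀⁻¹ * π).support (M.π₀⁻¹ * π) ω) := by
  set σ := M.π₀⁻¹ * π with hσdef
  have hσ : ∀ i, M.c (σ i) = M.c i := fun i => by
    have := M.π₀_comm (σ i)
    rw [this, hσdef, hπ i]
    simp
  set a : Sym2 (Fin n) → ℝ := fun e => if e ∈ (G₁ ω).edgeSet then (1 : ℝ) else 0 with ha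
  set b : Sym2 (Fin n) → ℝ := fun e => if e ∈ (sample₂ ω).edgeSet then (1 : ℝ) else 0 with hb
  have hcost : ∀ ρ : Equiv.Perm (Fin n), (∀ i, M.c (ρ i) = M.c i) →
      ∑ e, M.pairWeight e * |a e - b (pairPerm ρ e)| =
        ∑ e, M.pairWeight e * (a e + b e) -
          2 * ∑ e, M.pairWeight e * (a e * b (pairPerm ρ e)) := by
    intro ρ hρ
    have habs : ∀ e f, |a e - b f| = a e + b f - 2 * (a e * b f) := fun e f => by
      simp only [ha, hb]
      split_ifs <;> norm_num
    -- Reindexing by `ρ` is where the invariance of the weights under community-preserving maps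
    -- enters.
    have hre : ∑ e, M.pairWeight e * b (pairPerm ρ e) = ∑ e, M.pairWeight e * b e := by
      rw [← Equiv.sum_comp (pairPerm ρ) fun e => M.pairWeight e * b e]
      simp only [pairWeight, M.pairProb_pairPerm hρ]
    simp only [habs, mul_sub, mul_add, Finset.sum_sub_distrib, Finset.sum_add_distrib, hre]
    rw [Finset.mul_sum]
    congr 1
    exact Finset.sum_congr rfl fun e _ => by ring
  have hA : ∀ e (ρ : Equiv.Perm (Fin n)), ¬e.IsDiag →
      a e * b (pairPerm ρ e) = (coincidence ρ e).indicator 1 ω := by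
    intro e ρ hd
    have ha' : e ∈ (G₁ ω).edgeSet ↔ (ω e).1 = true ∧ (ω e).2.1 = true := by
      induction e with
      | _ u v =>
        rw [Sym2.mk_isDiag_iff] at hd
        simp [G₁, G, hd]
    have hb' : pairPerm ρ e ∈ (sample₂ ω).edgeSet ↔
        (ω (pairPerm ρ e)).1 = true ∧ (ω (pairPerm ρ e)).2.2 = true := by
      induction e with
      | _ u v =>
        rw [Sym2.mk_isDiag_iff] at hd
        simp [sample₂, G, hd, pairPerm_mk]
    simp only [ha, hb, ha', hb', Set.indicator_apply, coincidence, Set.mem_ofPred_eq, ite_and,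
      Pi.one_apply]
    split_ifs <;> simp
  have hone : M.π₀⁻¹ * M.π₀ = 1 := inv_mul_cancel _
  rw [M.cost_eq_sum_sym2, M.cost_eq_sum_sym2, hone]
  have h1 := hcost σ hσ
  have h2 := hcost 1 fun _ => rfl
  simp only [ha, hb] at h1 h2
  rw [h1, h2]
  have h3 : ∑ e, M.pairWeight e * (a e * b (pairPerm 1 e)) -
      ∑ e, M.pairWeight e * (a e * b (pairPerm σ e)) =
      M.coincidenceWeight σ.support 1 ω - M.coincidenceWeight σ.support σ ω := by
    rw [coincidenceWeight, coincidenceWeight, ← Finset.sum_sub_distrib, ← Finset.sum_sub_distrib]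
    symm
    refine Finset.sum_subset_zero_on_sdiff (Finset.subset_univ _) ?_ ?_
    · intro e he
      rw [Finset.mem_sdiff] at he
      by_cases hd : e.IsDiag
      · have : a e = 0 := if_neg fun h => SimpleGraph.not_isDiag_of_mem_edgeSet _ h hd
        simp [this]
      · rw [pairPerm_eq_self_of_notMem hd he.2, pairPerm_one]
        simp
    · intro e he
      rw [hA e _ (mem_pairsMeeting.1 he).1, hA e _ (mem_pairsMeeting.1 he).1]
  rw [← h3]
  ring

/-! ### Probabilities of coincidences -/

/-- The law of the three coins of a pair. -/
noncomputable def coinLaw (e : Sym2 (Fin n)) : Measure (Bool × Bool × Bool) :=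
  (bernoulliMeasure true false ⟨M.pairProb e, M.pairProb_mem e⟩).prod
    ((bernoulliMeasure true false ⟨M.s₁, M.s₁_pos.le, M.s₁_lt_one.le⟩).prod
      (bernoulliMeasure true false ⟨M.s₂, M.s₂_pos.le, M.s₂_lt_one.le⟩))

instance (e : Sym2 (Fin n)) : IsProbabilityMeasure (M.coinLaw e) := by
  unfold coinLaw; infer_instance

theorem law_eq_pi : M.law = Measure.pi M.coinLaw := rfl

instance : IsProbabilityMeasure M.law := by
  rw [law_eq_pi]; infer_instance

theorem coinLaw_real_prod (e : Sym2 (Fin n)) (A B C : Set Bool) :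
    (M.coinLaw e).real (A ×ˢ (B ×ˢ C)) =
      (bernoulliMeasure true false ⟨M.pairProb e, M.pairProb_mem e⟩).real A *
        ((bernoulliMeasure true false ⟨M.s₁, M.s₁_pos.le, M.s₁_lt_one.le⟩).real B *
          (bernoulliMeasure true false ⟨M.s₂, M.s₂_pos.le, M.s₂_lt_one.le⟩).real C) := by
  rw [coinLaw, measureReal_prod_prod, measureReal_prod_prod]

theorem bernoulliMeasure_real_true (p : unitInterval) :
    (bernoulliMeasure true false p).real {true} = p := by
  rw [bernoulliMeasure_real_apply_of_mem_of_notMem] <;> simp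

theorem coinLaw_real_fst (e : Sym2 (Fin n)) :
    (M.coinLaw e).real {x | x.1 = true ∧ x.2.1 = true} = M.pairProb e * M.s₁ := by
  have : {x : Bool × Bool × Bool | x.1 = true ∧ x.2.1 = true} =
      {true} ×ˢ ({true} ×ˢ Set.univ) := by ext; simp
  rw [this, coinLaw_real_prod, bernoulliMeasure_real_true, bernoulliMeasure_real_true]
  simp

theorem coinLaw_real_snd (e : Sym2 (Fin n)) :
    (M.coinLaw e).real {x | x.1 = true ∧ x.2.2 = true} = M.pairProb e * M.s₂ := by
  have : {x : Bool × Bool × Bool | x.1 = true ∧ x.2.2 = true} =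
      {true} ×ˢ (Set.univ ×ˢ {true}) := by ext; simp
  rw [this, coinLaw_real_prod, bernoulliMeasure_real_true, bernoulliMeasure_real_true]
  simp

theorem coinLaw_real_both (e : Sym2 (Fin n)) :
    (M.coinLaw e).real {x | (x.1 = true ∧ x.2.1 = true) ∧ (x.1 = true ∧ x.2.2 = true)} =
      M.pairProb e * M.s₁ * M.s₂ := by
  have : {x : Bool × Bool × Bool | (x.1 = true ∧ x.2.1 = true) ∧ (x.1 = true ∧ x.2.2 = true)} =
      {true} ×ˢ ({true} ×ˢ {true}) := by
    ext ⟨x, y, z⟩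
    simp
    tauto
  rw [this, coinLaw_real_prod, bernoulliMeasure_real_true, bernoulliMeasure_real_true,
    bernoulliMeasure_real_true]
  ring

theorem law_real_coincidence_of_eq {σ : Equiv.Perm (Fin n)} {e : Sym2 (Fin n)}
    (h : pairPerm σ e = e) : M.law.real (coincidence σ e) = M.pairProb e * M.s₁ * M.s₂ := by
  have hs : coincidence σ e = Function.eval e ⁻¹'
      {x | (x.1 = true ∧ x.2.1 = true) ∧ (x.1 = true ∧ x.2.2 = true)} := by
    ext ω
    simp [coincidence, h]
  rw [hs, law_eq_pi, (measurePreserving_eval M.coinLaw e).measureReal_preimage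
    MeasurableSet.of_discrete.nullMeasurableSet, coinLaw_real_both]

/-- The two pairs are different, so their coins are independent; the extra factor `p` separates
false coincidences from true ones. -/
theorem law_real_coincidence_of_ne {σ : Equiv.Perm (Fin n)} (hσ : ∀ i, M.c (σ i) = M.c i)
    {e : Sym2 (Fin n)} (h : pairPerm σ e ≠ e) :
    M.law.real (coincidence σ e) = M.pairProb e * (M.pairProb e * M.s₁ * M.s₂) := by
  have hs : coincidence σ e = Set.univ.pi fun f : Sym2 (Fin n) =>
      if f = e then {x | x.1 = true ∧ x.2.1 = true}
      else if f = pairPerm σ e then {x | x.1 = true ∧ x.2.2 = true} else Set.univ := by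
    ext ω
    simp only [coincidence, Set.mem_ofPred_eq, Set.mem_pi, Set.mem_univ, true_implies]
    constructor
    · rintro ⟨h1, h2⟩ f
      split_ifs with hf hf'
      · subst hf; exact h1
      · subst hf'; exact h2
      · trivial
    · intro hf
      refine ⟨?_, ?_⟩
      · simpa using hf e
      · simpa [h] using hf (pairPerm σ e)
  rw [hs, law_eq_pi, measureReal_def, Measure.pi_pi, ENNReal.toReal_prod]
  rw [Finset.prod_eq_mul e (pairPerm σ e) h.symm]
  · simp only [if_true, if_neg h, ← measureReal_def]
    rw [coinLaw_real_fst, coinLaw_real_snd, M.pairProb_pairPerm hσ]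
    ring
  · rintro f - ⟨h1, h2⟩
    simp [h1, h2]
  · simp
  · simp

theorem measureReal_le_coincidenceWeight (S : Finset (Fin n)) (σ : Equiv.Perm (Fin n))
    (t : ℝ) (a : ℝ) :
    M.law.real {ω | a ≤ t * M.coincidenceWeight S σ ω} ≤
      Real.exp (∑ e ∈ pairsMeeting S, M.law.real (coincidence σ e) *
        ((Real.exp (2 * (t * M.pairWeight e)) - 1) / 2) - a) := by
  classical
  have h := measureReal_le_sum_indicator M.coinLaw (pairPerm σ) (coincidence σ)
    (fun e => MeasurableSet.of_discrete) (fun e i h1 h2 x y => by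
      simp [coincidence, Function.update_of_ne h1.symm, Function.update_of_ne h2.symm])
    (fun e => if e ∈ pairsMeeting S then t * M.pairWeight e else 0) a
  rw [← law_eq_pi] at h
  have h1 : ∀ ω, ∑ e, (if e ∈ pairsMeeting S then t * M.pairWeight e else 0) *
      (coincidence σ e).indicator (1 : Outcome n → ℝ) ω = t * M.coincidenceWeight S σ ω := by
    intro ω
    rw [coincidenceWeight, Finset.mul_sum, ← Finset.sum_filter_add_sum_filter_not Finset.univ
      (· ∈ pairsMeeting S), Finset.filter_univ_mem]
    rw [Finset.sum_congr rfl fun e he => by rw [if_pos he],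
      Finset.sum_congr (s₁ := Finset.univ.filter (· ∉ pairsMeeting S)) rfl
        fun e he => by rw [if_neg (Finset.mem_filter.1 he).2]]
    simp [mul_assoc]
  have h2 : ∑ e, M.law.real (coincidence σ e) * (Real.exp
      (2 * (if e ∈ pairsMeeting S then t * M.pairWeight e else 0)) - 1) / 2 =
      ∑ e ∈ pairsMeeting S, M.law.real (coincidence σ e) *
        ((Real.exp (2 * (t * M.pairWeight e)) - 1) / 2) := by
    symm
    refine Finset.sum_subset_zero_on_sdiff (Finset.subset_univ _) ?_ ?_
    · intro e he
      rw [if_neg (Finset.mem_sdiff.1 he).2]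
      simp
    · intro e he
      rw [if_pos he]
      ring
  simp only [h1, h2] at h
  exact h

/-! ### Tails of the coincidence weights -/

variable {a b η : ℝ}

theorem card_mul_le_meanWeight (ha : 0 < a) (hη : 0 < η)
    (hp : ∀ e, a ≤ M.pairProb e ∧ M.pairProb e ≤ 1 - η) (S : Finset (Fin n)) :
    (pairsMeeting S).card *
      (η * (a * weight ((1 - M.s₁) * (1 - M.s₂)) a) * (M.s₁ * M.s₂)) ≤ M.meanWeight S := by
  rw [meanWeight, ← nsmul_eq_mul]
  refine Finset.card_nsmul_le_sum _ _ _ fun e _ => ?_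
  have := mul_weight_ge M.one_sub_mul_pos M.one_sub_mul_le_one ha (hp e).1 (hp e).2 hη
  have h12 : 0 ≤ M.s₁ * M.s₂ := (mul_pos M.s₁_pos M.s₂_pos).le
  calc _ ≤ M.pairProb e * weight ((1 - M.s₁) * (1 - M.s₂)) (M.pairProb e) * (M.s₁ * M.s₂) :=
        mul_le_mul_of_nonneg_right this h12
    _ = _ := by rw [pairWeight]; ring

/-- The lower tail of the weight of the true coincidences. -/
theorem law_real_coincidenceWeight_one_le (ha : 0 < a) (hη : 0 < η) (hη1 : η ≤ 1)
    (hp : ∀ e, a ≤ M.pairProb e ∧ M.pairProb e ≤ 1 - η) (S : Finset (Fin n)) :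
    M.law.real {ω | M.coincidenceWeight S 1 ω ≤ (1 - η / 4) * M.meanWeight S} ≤
      Real.exp (-(η ^ 3 / 128 * (a * (M.s₁ * M.s₂)) * (pairsMeeting S).card)) := by
  rcases (pairsMeeting S).eq_empty_or_nonempty with hS | ⟨e₀, -⟩
  · simp [hS]
  have ha1 : a < 1 := (hp e₀).1.trans_lt (M.pairProb_lt_one e₀)
  set W := weight ((1 - M.s₁) * (1 - M.s₂)) a with hW
  have hW0 : 0 < W := weight_pos M.one_sub_mul_pos ha ha1
  -- `W` is the largest possible weight, so every exponent is at most `η / 16`, the range of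
  -- `exp_neg_sub_one_le`.
  set l := η / (16 * W) with hl
  have hl0 : 0 < l := by positivity
  have hlW : l * W = η / 16 := by rw [hl]; field_simp
  have hset : {ω | M.coincidenceWeight S 1 ω ≤ (1 - η / 4) * M.meanWeight S} =
      {ω | -l * ((1 - η / 4) * M.meanWeight S) ≤ -l * M.coincidenceWeight S 1 ω} := by
    ext ω
    simp only [Set.mem_ofPred_eq, neg_mul, neg_le_neg_iff]
    rw [mul_le_mul_iff_right₀ hl0]
  rw [hset]
  refine (M.measureReal_le_coincidenceWeight S 1 _ _).trans (Real.exp_le_exp.2 ?_)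
  have hsum : ∑ e ∈ pairsMeeting S, M.law.real (coincidence 1 e) *
      ((Real.exp (2 * (-l * M.pairWeight e)) - 1) / 2) ≤
      -(l * (1 - η / 8)) * M.meanWeight S := by
    rw [meanWeight, Finset.mul_sum]
    refine Finset.sum_le_sum fun e _ => ?_
    rw [M.law_real_coincidence_of_eq (by rw [pairPerm_one]; rfl)]
    have h1 : l * M.pairWeight e ≤ η / 16 := by
      rw [← hlW]
      exact mul_le_mul_of_nonneg_left
        (weight_anti M.one_sub_mul_pos ha (hp e).1 (M.pairProb_lt_one e)) hl0.le
    have h2 := exp_neg_sub_one_le (mul_pos hl0 (M.pairWeight_pos e)).le h1 hη1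
    have h3 : 0 ≤ M.pairProb e * M.s₁ * M.s₂ :=
      (mul_pos (mul_pos (M.pairProb_pos e) M.s₁_pos) M.s₂_pos).le
    rw [neg_mul]
    calc _ ≤ M.pairProb e * M.s₁ * M.s₂ * -(l * M.pairWeight e * (1 - η / 8)) :=
          mul_le_mul_of_nonneg_left h2 h3
      _ = _ := by ring
  have hmean := mul_le_mul_of_nonneg_left (M.card_mul_le_meanWeight ha hη hp S)
    (show 0 ≤ l * η / 8 by positivity)
  have heq : l * η / 8 * ((pairsMeeting S).card * (η * (a * W) * (M.s₁ * M.s₂))) =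
      η ^ 3 / 128 * (a * (M.s₁ * M.s₂)) * (pairsMeeting S).card := by
    calc _ = l * W * (η ^ 2 / 8 * (a * (M.s₁ * M.s₂)) * (pairsMeeting S).card) := by ring
      _ = _ := by rw [hlW]; ring
  rw [heq] at hmean
  linarith

/-- The upper tail of the weight of the coincidences under a mapping. -/
theorem law_real_le_coincidenceWeight (ha : 0 < a) (hη : 0 < η) (hb : b ≤ 1 - η)
    (hp : ∀ e, a ≤ M.pairProb e ∧ M.pairProb e ≤ b)
    {σ : Equiv.Perm (Fin n)} (hσ : ∀ i, M.c (σ i) = M.c i) :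
    M.law.real {ω | (1 - 3 * η / 4) * M.meanWeight σ.support ≤
        M.coincidenceWeight σ.support σ ω} ≤
      Real.exp (σ.support.card - η / 128 * (Real.log (1 / b) * (a * (M.s₁ * M.s₂))) *
        (pairsMeeting σ.support).card) := by
  rcases (pairsMeeting σ.support).eq_empty_or_nonempty with hS | ⟨e₀, -⟩
  · refine measureReal_le_one.trans ?_
    simp [hS]
  set S := σ.support with hSdef
  have hb0 : 0 < b := ha.trans_le ((hp e₀).1.trans (hp e₀).2)
  have hb1 : b < 1 := by linarith
  have hLb := log_one_div_pos hb0 hb1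
  set W := weight ((1 - M.s₁) * (1 - M.s₂)) b with hW
  have hW0 : 0 < W := weight_pos M.one_sub_mul_pos hb0 hb1
  -- Since `weight q p / log (1 / p)` increases with `p`, calibrating `θ` at the largest affinity
  -- `b` gives `θ w ≤ log (1 / p) / 16` for every pair.
  set θ := Real.log (1 / b) / (16 * W) with hθ
  have hθ0 : 0 < θ := by positivity
  have hθW : θ * W = Real.log (1 / b) / 16 := by rw [hθ]; field_simp
  have hset : {ω | (1 - 3 * η / 4) * M.meanWeight S ≤ M.coincidenceWeight S σ ω} =
      {ω | θ * ((1 - 3 * η / 4) * M.meanWeight S) ≤ θ * M.coincidenceWeight S σ ω} := by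
    ext ω
    simp only [Set.mem_ofPred_eq]
    rw [mul_le_mul_iff_right₀ hθ0]
  rw [hset]
  refine (M.measureReal_le_coincidenceWeight S σ _ _).trans (Real.exp_le_exp.2 ?_)
  have hη1 : 0 ≤ 1 - 7 * η / 8 := by linarith
  have hx : ∀ e, θ * M.pairWeight e ≤ Real.log (1 / M.pairProb e) / 16 := by
    intro e
    have h1 := log_mul_weight_le M.one_sub_mul_pos M.one_sub_mul_le_one (M.pairProb_pos e)
      (hp e).2 hb1
    rw [hθ, div_mul_eq_mul_div, div_le_iff₀ (by positivity)]
    calc _ ≤ Real.log (1 / M.pairProb e) * W := h1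
      _ = _ := by ring
  have hsum : ∑ e ∈ pairsMeeting S, M.law.real (coincidence σ e) *
      ((Real.exp (2 * (θ * M.pairWeight e)) - 1) / 2) ≤
      θ * (1 - 7 * η / 8) * M.meanWeight S + S.card := by
    have hterm : ∀ e ∈ pairsMeeting S, M.law.real (coincidence σ e) *
        ((Real.exp (2 * (θ * M.pairWeight e)) - 1) / 2) ≤
        θ * (1 - 7 * η / 8) * (M.pairWeight e * (M.pairProb e * M.s₁ * M.s₂)) +
          if pairPerm σ e = e then 1 else 0 := by
      intro e _
      have hx0 : 0 ≤ θ * M.pairWeight e := (mul_pos hθ0 (M.pairWeight_pos e)).le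
      have hp0 := M.pairProb_pos e
      have hs1 := M.s₁_pos
      have hs2 := M.s₂_pos
      have hw := M.pairWeight_pos e
      have hs : M.s₁ * M.s₂ ≤ 1 :=
        mul_le_one₀ M.s₁_lt_one.le M.s₂_pos.le M.s₂_lt_one.le
      split_ifs with hfix
      · rw [M.law_real_coincidence_of_eq hfix]
        have h1 := mul_exp_sub_one_le_one hp0 (M.pairProb_lt_one e) hx0 (hx e)
        have h2 : 0 ≤ (Real.exp (2 * (θ * M.pairWeight e)) - 1) / 2 := by
          have := Real.one_le_exp (x := 2 * (θ * M.pairWeight e)) (by linarith)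
          linarith
        have h3 : 0 ≤ θ * (1 - 7 * η / 8) * (M.pairWeight e * (M.pairProb e * M.s₁ * M.s₂)) := by
          positivity
        have h4 : M.pairProb e * M.s₁ * M.s₂ * ((Real.exp (2 * (θ * M.pairWeight e)) - 1) / 2) ≤
            1 * 1 := by
          calc _ = (M.pairProb e * ((Real.exp (2 * (θ * M.pairWeight e)) - 1) / 2)) *
                (M.s₁ * M.s₂) := by ring
            _ ≤ 1 * 1 := by gcongr
        linarith
      · rw [M.law_real_coincidence_of_ne hσ hfix, add_zero]
        have h1 := mul_exp_sub_one_le hp0 ((hp e).2.trans hb) hx0 (hx e) hη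
        calc _ = M.pairProb e * ((Real.exp (2 * (θ * M.pairWeight e)) - 1) / 2) *
              (M.pairProb e * M.s₁ * M.s₂) := by ring
          _ ≤ θ * M.pairWeight e * (1 - 7 * η / 8) * (M.pairProb e * M.s₁ * M.s₂) := by
              gcongr
          _ = _ := by ring
    refine (Finset.sum_le_sum hterm).trans ?_
    rw [Finset.sum_add_distrib, ← Finset.mul_sum, Finset.sum_boole]
    exact add_le_add le_rfl (by exact_mod_cast card_fixed_pairs_le σ)
  have hmean : θ * M.meanWeight S ≥
      (pairsMeeting S).card * (Real.log (1 / b) / 16 * (a * (M.s₁ * M.s₂))) := by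
    rw [meanWeight, Finset.mul_sum, ← nsmul_eq_mul]
    refine Finset.card_nsmul_le_sum _ _ _ fun e _ => ?_
    have h1 : W ≤ M.pairWeight e :=
      weight_anti M.one_sub_mul_pos (M.pairProb_pos e) (hp e).2 hb1
    have hs1 := M.s₁_pos
    have hs2 := M.s₂_pos
    calc _ = θ * W * (a * (M.s₁ * M.s₂)) := by rw [hθW]
      _ ≤ θ * M.pairWeight e * (M.pairProb e * (M.s₁ * M.s₂)) := by
          have := (hp e).1
          have := M.pairWeight_pos e
          gcongr
      _ = _ := by ring
  -- The threshold factor `1 - 3η/4` exceeds the factor `1 - 7η/8` of the moment bound by `η / 8`.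
  have := mul_le_mul_of_nonneg_left hmean (show 0 ≤ η / 8 by positivity)
  linarith

end Model

/-! ### Sums over sets and over permutations by support -/

section Counting

variable {n : ℕ}

theorem sum_pow_card (y : ℝ) : ∑ S : Finset (Fin n), y ^ S.card = (1 + y) ^ n := by
  have := Finset.sum_pow_mul_eq_add_pow y 1 (Finset.univ : Finset (Fin n))
  simpa [add_comm y 1] using this

/-- A permutation is determined by its values on its support. -/
theorem card_support_eq_le (S : Finset (Fin n)) :
    (Finset.univ.filter fun σ : Equiv.Perm (Fin n) => σ.support = S).card ≤ n ^ S.card := by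
  have h := Finset.card_le_card_of_injOn (t := (Finset.univ : Finset (S → Fin n)))
    (s := Finset.univ.filter fun σ : Equiv.Perm (Fin n) => σ.support = S)
    (fun σ v => σ v) (fun _ _ => Finset.mem_coe.2 (Finset.mem_univ _)) (by
      intro σ hσ τ hτ h
      simp only [Finset.coe_filter, Finset.mem_univ, true_and, Set.mem_ofPred_eq] at hσ hτ
      ext1 v
      by_cases hv : v ∈ S
      · exact congrFun h ⟨v, hv⟩
      · rw [Equiv.Perm.notMem_support.1 (hσ ▸ hv), Equiv.Perm.notMem_support.1 (hτ ▸ hv)])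
  simpa using h

theorem sum_pow_card_support_le {x : ℝ} (hx : 0 ≤ x) :
    ∑ σ : Equiv.Perm (Fin n), x ^ σ.support.card ≤ (1 + n * x) ^ n := by
  classical
  rw [← sum_pow_card, ← Finset.sum_fiberwise (s := Finset.univ)
    (g := fun σ : Equiv.Perm (Fin n) => σ.support)]
  refine Finset.sum_le_sum fun S _ => ?_
  rw [Finset.sum_congr rfl fun σ hσ => by rw [(Finset.mem_filter.1 hσ).2], Finset.sum_const,
    nsmul_eq_mul, mul_pow]
  have := card_support_eq_le S
  gcongr
  exact_mod_cast this

theorem one_add_pow_le_exp {y : ℝ} (hy : 0 ≤ y) : (1 + y) ^ n ≤ Real.exp (n * y) := by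
  rw [Real.exp_nat_mul]
  have := Real.add_one_le_exp y
  gcongr
  linarith

end Counting

/-! ### Union bound and density conditions -/

namespace Model

variable {n : ℕ} (M : Model n)

theorem c_inv_mul_apply {π : Equiv.Perm (Fin n)} (hπ : π ∈ M.mappings) (i : Fin n) :
    M.c ((M.π₀⁻¹ * π) i) = M.c i := by
  rw [M.π₀_comm, hπ i]
  simp

theorem numCorrect_add_card_support (π : Equiv.Perm (Fin n)) :
    M.numCorrect π + (M.π₀⁻¹ * π).support.card = n := by
  have h : (M.π₀⁻¹ * π).support = Finset.univ.filter fun i => ¬π i = M.π₀ i := by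
    ext i
    simp [Equiv.symm_apply_eq]
  rw [numCorrect, h, Finset.card_filter_add_card_filter_not]
  simp

theorem minCost_le (ω : Outcome n) : M.minCost ω ≤ M.cost ω M.π₀ :=
  ciInf_le (f := fun π : M.mappings => M.cost ω π) (Set.finite_range _).bddBelow
    ⟨M.π₀, M.π₀_comm⟩

variable {a b η δ t : ℝ}

theorem card_mul_le_card_pairsMeeting_real (hn : 2 ≤ n) (S : Finset (Fin n)) :
    (S.card * n / 4 : ℝ) ≤ (pairsMeeting S).card := by
  have h := card_mul_le_card_pairsMeeting S
  have h' : (S.card : ℝ) * (n - 1) ≤ 2 * (pairsMeeting S).card := by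
    have : ((n - 1 : ℕ) : ℝ) = n - 1 := by rw [Nat.cast_sub (by omega)]; simp
    rw [← this]
    exact_mod_cast h
  have hn' : (2 : ℝ) ≤ n := by exact_mod_cast hn
  nlinarith [(S.card.cast_nonneg : (0 : ℝ) ≤ S.card)]

/-- If the weights of true and false coincidences behave, mappings of nearly minimal cost are
nearly correct. -/
theorem mem_accurate (hn : 2 ≤ n) (ha : 0 < a) (hη : 0 < η) (hδ : 0 ≤ δ)
    (hp : ∀ e, a ≤ M.pairProb e ∧ M.pairProb e ≤ 1 - η)
    (ht : t ≤ η ^ 2 / 4 * (δ * (a * (M.s₁ * M.s₂) * Real.log (1 / a))) * n ^ 2) {ω : Outcome n}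
    (hY : ∀ S : Finset (Fin n), δ * n < S.card →
      (1 - η / 4) * M.meanWeight S < M.coincidenceWeight S 1 ω)
    (hZ : ∀ σ : Equiv.Perm (Fin n), (∀ i, M.c (σ i) = M.c i) → σ ≠ 1 →
      M.coincidenceWeight σ.support σ ω < (1 - 3 * η / 4) * M.meanWeight σ.support) :
    ω ∈ M.accurate t ((1 - δ) * n) := by
  intro π hπ hcost
  by_contra! hlt
  set σ := M.π₀⁻¹ * π with hσ
  have hnc : (M.numCorrect π : ℝ) + σ.support.card = n := by
    exact_mod_cast M.numCorrect_add_card_support π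
  have hk : δ * n < σ.support.card := by linarith
  have hσ1 : σ ≠ 1 := by
    intro h
    rw [h] at hk
    simp only [Equiv.Perm.support_one, Finset.card_empty, Nat.cast_zero] at hk
    linarith [mul_nonneg hδ (n.cast_nonneg : (0 : ℝ) ≤ n)]
  have h1 := hY _ hk
  have h2 := hZ σ (M.c_inv_mul_apply hπ) hσ1
  have h3 := M.cost_sub_cost ω hπ
  have h4 := M.minCost_le ω
  have h5 := M.card_mul_le_meanWeight ha hη hp σ.support
  have h6 := card_mul_le_card_pairsMeeting_real hn σ.support
  have ha1 : a < 1 := (hp (s(⟨0, by omega⟩, ⟨0, by omega⟩))).1.trans_lt (M.pairProb_lt_one _)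
  have hL := log_one_div_pos ha ha1
  have hLW := log_one_div_le_weight M.one_sub_mul_pos M.one_sub_mul_le_one ha ha1
  have hs1 := M.s₁_pos
  have hs2 := M.s₂_pos
  -- The two tail bounds leave `Y - Z` above `η / 2` times `meanWeight`, so the excess cost is above
  -- `η * meanWeight`, which dominates `t`.
  have h7 : η ^ 2 / 4 * (δ * (a * (M.s₁ * M.s₂) * Real.log (1 / a))) * n ^ 2 ≤
      η * M.meanWeight σ.support := by
    calc _ = δ * n * n / 4 * (η * (η * (a * Real.log (1 / a)) * (M.s₁ * M.s₂))) := by ring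
      _ ≤ σ.support.card * n / 4 * (η * (η * (a * Real.log (1 / a)) * (M.s₁ * M.s₂))) := by
          gcongr
      _ ≤ (pairsMeeting σ.support).card * (η * (η * (a *
            weight ((1 - M.s₁) * (1 - M.s₂)) a) * (M.s₁ * M.s₂))) := by gcongr
      _ = η * ((pairsMeeting σ.support).card * (η * (a *
            weight ((1 - M.s₁) * (1 - M.s₂)) a) * (M.s₁ * M.s₂))) := by ring
      _ ≤ _ := by gcongr
  linarith

/-- The failure probability for a fixed number of nodes. -/
theorem one_sub_le_law_real_accurate (hn : 2 ≤ n) (ha : 0 < a) (hη : 0 < η) (hη1 : η ≤ 1)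
    (hδ : 0 ≤ δ) (hb : b ≤ 1 - η) (hp : ∀ e, a ≤ M.pairProb e ∧ M.pairProb e ≤ b)
    (ht : t ≤ η ^ 2 / 4 * (δ * (a * (M.s₁ * M.s₂) * Real.log (1 / a))) * n ^ 2) {u v : ℝ}
    (hu : u ≤ η ^ 3 / 512 * (a * (M.s₁ * M.s₂)) * n)
    (hv : v ≤ η / 512 * (Real.log (1 / b) * (a * (M.s₁ * M.s₂))) * n) :
    1 - (∑ S : Finset (Fin n) with δ * n < S.card, Real.exp (-u) ^ S.card) -
      (Real.exp (n * (n * Real.exp (1 - v))) - 1) ≤ M.law.real (M.accurate t ((1 - δ) * n)) := by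
  classical
  have hp' : ∀ e, a ≤ M.pairProb e ∧ M.pairProb e ≤ 1 - η := fun e =>
    ⟨(hp e).1, (hp e).2.trans hb⟩
  have hcard := fun S : Finset (Fin n) => card_mul_le_card_pairsMeeting_real hn S
  have hs1 := M.s₁_pos
  have hs2 := M.s₂_pos
  have e₀ : Sym2 (Fin n) := s(⟨0, by omega⟩, ⟨0, by omega⟩)
  have hLb := log_one_div_pos (ha.trans_le ((hp e₀).1.trans (hp e₀).2)) (by linarith : b < 1)
  set badY : Finset (Fin n) → Set (Outcome n) := fun S =>
    {ω | M.coincidenceWeight S 1 ω ≤ (1 - η / 4) * M.meanWeight S}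
  -- With the community condition inside the event, the union may run over all permutations: the
  -- others contribute the empty event.
  set badZ : Equiv.Perm (Fin n) → Set (Outcome n) := fun σ =>
    {ω | (∀ i, M.c (σ i) = M.c i) ∧
      (1 - 3 * η / 4) * M.meanWeight σ.support ≤ M.coincidenceWeight σ.support σ ω}
  set TY := Finset.univ.filter fun S : Finset (Fin n) => δ * n < S.card with hTY
  set TZ := Finset.univ.erase (1 : Equiv.Perm (Fin n)) with hTZ
  have hsub : (M.accurate t ((1 - δ) * n))ᶜ ⊆ (⋃ S ∈ TY, badY S) ∪ ⋃ σ ∈ TZ, badZ σ := by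
    intro ω hω
    by_contra hbad
    refine hω (M.mem_accurate hn ha hη hδ hp' ht (fun S hS => ?_) fun σ hσ hσ1 => ?_)
    · by_contra! h
      exact hbad (Or.inl (Set.mem_biUnion (x := S) (by simpa [hTY] using hS) h))
    · by_contra! h
      exact hbad (Or.inr (Set.mem_biUnion (x := σ) (by simpa [hTZ] using hσ1) ⟨hσ, h⟩))
  have hY : ∀ S, M.law.real (badY S) ≤ Real.exp (-u) ^ S.card := by
    intro S
    refine (M.law_real_coincidenceWeight_one_le ha hη hη1 hp' S).trans ?_
    rw [← Real.exp_nat_mul, Real.exp_le_exp]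
    have h1 := mul_le_mul_of_nonneg_left (hcard S)
      (show 0 ≤ η ^ 3 / 128 * (a * (M.s₁ * M.s₂)) by positivity)
    have h2 := mul_le_mul_of_nonneg_left hu (S.card.cast_nonneg : (0 : ℝ) ≤ S.card)
    linarith
  have hZ : ∀ σ, M.law.real (badZ σ) ≤ Real.exp (1 - v) ^ σ.support.card := by
    intro σ
    by_cases hσ : ∀ i, M.c (σ i) = M.c i
    · have : badZ σ = {ω | (1 - 3 * η / 4) * M.meanWeight σ.support ≤
          M.coincidenceWeight σ.support σ ω} := by
        ext ω
        exact and_iff_right hσ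
      rw [this]
      refine (M.law_real_le_coincidenceWeight ha hη hb hp hσ).trans ?_
      rw [← Real.exp_nat_mul, Real.exp_le_exp]
      have h1 := mul_le_mul_of_nonneg_left (hcard σ.support)
        (show 0 ≤ η / 128 * (Real.log (1 / b) * (a * (M.s₁ * M.s₂))) by positivity)
      have h2 := mul_le_mul_of_nonneg_left hv
        (σ.support.card.cast_nonneg : (0 : ℝ) ≤ σ.support.card)
      linarith
    · have : badZ σ = ∅ := Set.eq_empty_of_forall_notMem fun ω h => hσ h.1
      rw [this, measureReal_empty]
      positivity
  have hcompl : M.law.real (M.accurate t ((1 - δ) * n))ᶜ ≤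
      ∑ S ∈ TY, Real.exp (-u) ^ S.card + ∑ σ ∈ TZ, Real.exp (1 - v) ^ σ.support.card := by
    refine (measureReal_mono hsub).trans ((measureReal_union_le _ _).trans (add_le_add ?_ ?_))
    · exact (measureReal_biUnion_finset_le _ _).trans (Finset.sum_le_sum fun S _ => hY S)
    · exact (measureReal_biUnion_finset_le _ _).trans (Finset.sum_le_sum fun σ _ => hZ σ)
  have hTZsum : ∑ σ ∈ TZ, Real.exp (1 - v) ^ σ.support.card ≤
      Real.exp (n * (n * Real.exp (1 - v))) - 1 := by
    -- The identity contributes exactly the `1` that is subtracted.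
    have h1 := Finset.add_sum_erase Finset.univ
      (fun σ : Equiv.Perm (Fin n) => Real.exp (1 - v) ^ σ.support.card) (Finset.mem_univ 1)
    simp only [Equiv.Perm.support_one, Finset.card_empty, pow_zero] at h1
    have h2 := sum_pow_card_support_le (n := n) (Real.exp_pos (1 - v)).le
    have h3 := one_add_pow_le_exp (n := n) (y := n * Real.exp (1 - v)) (by positivity)
    linarith
  have := probReal_compl_eq_one_sub (μ := M.law) (s := M.accurate t ((1 - δ) * n))
    MeasurableSet.of_discrete
  linarith

theorem α_le_pairProb (e : Sym2 (Fin n)) : M.α ≤ M.pairProb e := by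
  induction e with
  | _ u v =>
    exact ciInf_le (f := fun ab : Fin M.κ × Fin M.κ => M.p ab.1 ab.2)
      (Set.finite_range _).bddBelow (M.c u, M.c v)

theorem pairProb_le_β (e : Sym2 (Fin n)) : M.pairProb e ≤ M.β := by
  induction e with
  | _ u v =>
    exact le_ciSup (f := fun ab : Fin M.κ × Fin M.κ => M.p ab.1 ab.2)
      (Set.finite_range _).bddAbove (M.c u, M.c v)

theorem α_pos (hn : 0 < n) : 0 < M.α := by
  have : Nonempty (Fin M.κ) := ⟨M.c ⟨0, hn⟩⟩
  obtain ⟨ab, h⟩ := exists_eq_ciInf_of_finite (f := fun ab : Fin M.κ × Fin M.κ => M.p ab.1 ab.2)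
  rw [α, ← h]
  exact M.p_pos _ _

theorem α_le_β (hn : 0 < n) : M.α ≤ M.β :=
  (M.α_le_pairProb s(⟨0, hn⟩, ⟨0, hn⟩)).trans (M.pairProb_le_β _)

/-- The factors dropped here, `(1 - β)²` and `s₁ s₂ / (s₁ + s₂)`, are at most `1`. -/
theorem density_le (hn : 0 < n) (hβ : M.β < 1) :
    M.density ≤ M.α * (M.s₁ * M.s₂) * Real.log (1 / M.α) := by
  have hs1 := M.s₁_pos
  have hs2 := M.s₂_pos
  have hα := M.α_pos hn
  have hβ0 := hα.trans_le (M.α_le_β hn)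
  have hL := log_one_div_pos hα ((M.α_le_β hn).trans_lt hβ)
  rw [density, div_le_iff₀ (by positivity)]
  have h1 : (1 - M.β) ^ 2 ≤ 1 := pow_le_one₀ (by linarith) (by linarith)
  have h2 : M.s₁ * M.s₂ ≤ M.s₁ + M.s₂ := by nlinarith [M.s₂_lt_one]
  calc _ = M.α * (M.s₁ * M.s₂) * Real.log (1 / M.α) * ((1 - M.β) ^ 2 * (M.s₁ * M.s₂)) := by ring
    _ ≤ M.α * (M.s₁ * M.s₂) * Real.log (1 / M.α) * (1 * (M.s₁ + M.s₂)) := by gcongr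
    _ = _ := by ring

/-- The density conditions in the form in which they enter the failure probability. -/
theorem density_conditions {c₀ γ δ : ℝ} (hn : 2 ≤ n) (hβ : M.β < 1) (hc₀ : 0 < c₀)
    (hδ : 0 ≤ δ) (hδ1 : δ ≤ 1) (hγ : Real.log M.α / Real.log M.β ≤ γ)
    (hd : c₀ * (γ * Real.log n ^ 2 / ((1 - δ / 2) * n)) ≤ M.density)
    (hd1 : 1 ≤ n * M.density) :
    c₀ * Real.log n ^ 2 ≤ Real.log (1 / M.β) * (M.α * (M.s₁ * M.s₂)) * n ∧
      c₀ / 4 * Real.log n ≤ M.α * (M.s₁ * M.s₂) * n := by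
  have hs1 := M.s₁_pos
  have hs2 := M.s₂_pos
  have hα := M.α_pos (by omega)
  have hαβ := M.α_le_β (by omega)
  have hα1 := hαβ.trans_lt hβ
  have hLa := log_one_div_pos hα hα1
  have hLb := log_one_div_pos (hα.trans_le hαβ) hβ
  have hn2 : (2 : ℝ) ≤ n := by exact_mod_cast hn
  have hln : 0 < Real.log n := Real.log_pos (by linarith)
  have hdle := M.density_le (by omega) hβ
  have hγ' : Real.log (1 / M.α) / Real.log (1 / M.β) ≤ γ := by
    rw [one_div, one_div, Real.log_inv, Real.log_inv, neg_div_neg_eq]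
    exact hγ
  have hγ0 : 0 < γ := (div_pos hLa hLb).trans_le hγ'
  rw [div_le_iff₀ hLb] at hγ'
  have h1 : c₀ * Real.log n ^ 2 ≤ Real.log (1 / M.β) * (M.α * (M.s₁ * M.s₂)) * n := by
    have h2 : c₀ * (γ * Real.log n ^ 2 / n) ≤ c₀ * (γ * Real.log n ^ 2 / ((1 - δ / 2) * n)) := by
      have : 0 < (1 - δ / 2) * n := mul_pos (by linarith) (by linarith)
      gcongr
      nlinarith
    have h3 : c₀ * (γ * Real.log n ^ 2 / n) ≤
        M.α * (M.s₁ * M.s₂) * (γ * Real.log (1 / M.β)) := by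
      refine h2.trans (hd.trans (hdle.trans ?_))
      gcongr
    refine le_of_mul_le_mul_left ?_ hγ0
    have h4 := mul_le_mul_of_nonneg_right h3 (show (0 : ℝ) ≤ n by linarith)
    calc _ = c₀ * (γ * Real.log n ^ 2 / n) * n := by field_simp
      _ ≤ _ := h4
      _ = _ := by ring
  refine ⟨h1, ?_⟩
  -- The networks cannot be too sparse: `hd1` gives `x ≤ n log x ≤ 2 n √x` for `x = 1 / α`, hence
  -- `√x ≤ 2 n ≤ n ^ 2`. Dividing the first conclusion by `log (1 / β) ≤ 4 log n` then yields the
  -- second.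
  have hLn : Real.log (1 / M.α) ≤ 4 * Real.log n := by
    set x := 1 / M.α with hx
    have hx0 : 0 < x := by positivity
    have h2 : x ≤ n * Real.log x := by
      have h3 : 1 ≤ n * (M.α * Real.log x) := by
        refine hd1.trans (mul_le_mul_of_nonneg_left (hdle.trans ?_) (by linarith))
        have : M.s₁ * M.s₂ ≤ 1 := mul_le_one₀ M.s₁_lt_one.le hs2.le M.s₂_lt_one.le
        calc _ = M.s₁ * M.s₂ * (M.α * Real.log x) := by ring
          _ ≤ 1 * (M.α * Real.log x) := by gcongr
          _ = _ := one_mul _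
      rw [hx, div_le_iff₀ hα, ← hx]
      linarith
    have h4 : Real.log x ≤ 2 * √x := by
      have := Real.log_le_sub_one_of_pos (Real.sqrt_pos.2 hx0)
      rw [Real.log_sqrt hx0.le] at this
      linarith
    have hsq : √x * √x = x := Real.mul_self_sqrt hx0.le
    have hsx := Real.sqrt_pos.2 hx0
    have h5 : √x ≤ 2 * n := by
      by_contra! h
      nlinarith
    have h6 : √x ≤ (n : ℝ) ^ 2 := by nlinarith
    have h7 := Real.log_le_log hsx h6
    rw [Real.log_sqrt hx0.le, Real.log_pow] at h7
    push_cast at h7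
    linarith
  have hLbn : Real.log (1 / M.β) ≤ 4 * Real.log n := by
    refine le_trans (Real.log_le_log ?_ ?_) hLn
    · have := hα.trans_le hαβ
      positivity
    · gcongr
  refine le_of_mul_le_mul_left ?_ (show 0 < 4 * Real.log n by positivity)
  calc _ = c₀ * Real.log n ^ 2 := by ring
    _ ≤ Real.log (1 / M.β) * (M.α * (M.s₁ * M.s₂) * n) := by rw [← mul_assoc]; exact h1
    _ ≤ _ := by gcongr

end Model

/-! ### Both failure bounds tend to zero -/

section Asymptotics

theorem tendsto_log_natCast : Tendsto (fun n : ℕ => Real.log n) atTop atTop :=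
  Real.tendsto_log_atTop.comp tendsto_natCast_atTop_atTop

theorem tendsto_exp_mul_exp_sub_one {c : ℝ} (hc : 0 < c) :
    Tendsto (fun n : ℕ => Real.exp (n * (n * Real.exp (1 - c * Real.log n ^ 2))) - 1)
      atTop (𝓝 0) := by
  have h1 : Tendsto (fun x : ℝ => x * (c * x - 2)) atTop atTop :=
    tendsto_id.atTop_mul_atTop₀
      (tendsto_atTop_add_const_right _ _ (tendsto_id.const_mul_atTop hc))
  have h2 : Tendsto (fun x : ℝ => Real.exp (1 - x * (c * x - 2))) atTop (𝓝 0) := by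
    refine Real.tendsto_exp_atBot.comp ?_
    simp only [sub_eq_add_neg (1 : ℝ)]
    exact tendsto_atBot_add_const_left _ _ (tendsto_neg_atTop_atBot.comp h1)
  have h3 : Tendsto (fun n : ℕ => (n : ℝ) * (n * Real.exp (1 - c * Real.log n ^ 2)))
      atTop (𝓝 0) := by
    refine (h2.comp tendsto_log_natCast).congr' ?_
    filter_upwards [eventually_gt_atTop 0] with n hn
    have hn' : (0 : ℝ) < n := by exact_mod_cast hn
    have h4 : (n : ℝ) * (n * Real.exp (1 - c * Real.log n ^ 2)) =
        Real.exp (Real.log n) * (Real.exp (Real.log n) * Real.exp (1 - c * Real.log n ^ 2)) := by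
      rw [Real.exp_log hn']
    rw [h4, ← Real.exp_add, ← Real.exp_add, Function.comp_apply]
    congr 1
    ring
  have := (Real.continuous_exp.tendsto 0).comp h3
  simpa using this.sub_const 1

/-- For `δ = 0` the nonempty sets contribute at most `(1 + n ^ (-c)) ^ n - 1`, which `c ≥ 2` bounds
by `exp (1 / n) - 1`. For `δ > 0` each of the at most `2 ^ n` terms is at most `exp (-c δ n log n)`,
so any `c > 0` will do. -/
theorem tendsto_sum_exp_pow_card {c δ : ℝ} (hc : 0 < c) (hδ : 0 ≤ δ) (hc2 : δ = 0 → 2 ≤ c) :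
    Tendsto (fun n : ℕ => ∑ S : Finset (Fin n) with δ * n < S.card,
      Real.exp (-(c * Real.log n)) ^ S.card) atTop (𝓝 0) := by
  have hnonneg : ∀ n : ℕ, 0 ≤ ∑ S : Finset (Fin n) with δ * n < S.card,
      Real.exp (-(c * Real.log n)) ^ S.card := fun n =>
    Finset.sum_nonneg fun _ _ => by positivity
  rcases hδ.eq_or_lt with rfl | hδ
  · have hlim : Tendsto (fun n : ℕ => Real.exp (1 / n) - 1) atTop (𝓝 0) := by
      have := (Real.continuous_exp.tendsto 0).comp
        (tendsto_one_div_atTop_nhds_zero_nat (𝕜 := ℝ))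
      simpa using this.sub_const 1
    refine squeeze_zero' (Eventually.of_forall hnonneg) ?_ hlim
    filter_upwards [eventually_gt_atTop 0] with n hn
    have hn' : (1 : ℝ) ≤ n := by exact_mod_cast hn
    set y := Real.exp (-(c * Real.log n)) with hy
    have hy0 : 0 < y := Real.exp_pos _
    have hfilter : (Finset.univ.filter fun S : Finset (Fin n) => (0 : ℝ) * n < S.card) =
        Finset.univ.erase ∅ := by
      ext S
      simp [Finset.nonempty_iff_ne_empty]
    have h1 := Finset.add_sum_erase Finset.univ (fun S : Finset (Fin n) => y ^ S.card)
      (Finset.mem_univ ∅)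
    simp only [Finset.card_empty, pow_zero] at h1
    rw [sum_pow_card] at h1
    have h2 := one_add_pow_le_exp (n := n) hy0.le
    have h3 : (n : ℝ) * y ≤ 1 / n := by
      rw [le_div_iff₀ (by linarith)]
      have h4 : n * y * n = Real.exp (Real.log n) * y * Real.exp (Real.log n) := by
        rw [Real.exp_log (by linarith)]
      rw [h4, hy, ← Real.exp_add, ← Real.exp_add, Real.exp_le_one_iff]
      nlinarith [Real.log_nonneg hn', hc2 rfl]
    rw [hfilter]
    linarith [Real.exp_le_exp.2 h3]
  · have hlim : Tendsto (fun n : ℕ => Real.exp (-(n * (c * δ * Real.log n - Real.log 2))))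
        atTop (𝓝 0) := by
      refine Real.tendsto_exp_atBot.comp (tendsto_neg_atTop_atBot.comp ?_)
      exact tendsto_natCast_atTop_atTop.atTop_mul_atTop₀
        (tendsto_atTop_add_const_right _ _
          (tendsto_log_natCast.const_mul_atTop (mul_pos hc hδ)))
    refine squeeze_zero' (Eventually.of_forall hnonneg) ?_ hlim
    filter_upwards [eventually_gt_atTop 0] with n hn
    have hn' : (1 : ℝ) ≤ n := by exact_mod_cast hn
    have hln := Real.log_nonneg hn'
    have h1 : ∀ S ∈ Finset.univ.filter (fun S : Finset (Fin n) => δ * n < S.card),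
        Real.exp (-(c * Real.log n)) ^ S.card ≤ Real.exp (-(c * δ * Real.log n * n)) := by
      intro S hS
      have hS := (Finset.mem_filter.1 hS).2.le
      rw [← Real.exp_nat_mul, Real.exp_le_exp]
      have := mul_le_mul_of_nonneg_left hS (mul_nonneg hc.le hln)
      linarith
    have hexp0 := (Real.exp_pos (-(c * δ * Real.log n * n))).le
    calc _ ≤ _ := Finset.sum_le_card_nsmul _ _ _ h1
      _ ≤ (2 : ℝ) ^ n * Real.exp (-(c * δ * Real.log n * n)) := by
          rw [nsmul_eq_mul]
          gcongr
          have := Finset.card_le_univ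
            (Finset.univ.filter fun S : Finset (Fin n) => δ * n < S.card)
          rw [Fintype.card_finset, Fintype.card_fin] at this
          exact_mod_cast this
      _ = _ := by
          nth_rewrite 1 [← Real.exp_log (zero_lt_two' ℝ)]
          rw [← Real.exp_nat_mul, ← Real.exp_add]
          congr 1
          ring

end Asymptotics

end Deanon

/-! ### Choice of constants and conclusion -/

theorem corollary4p1 (η : ℝ) (hη : 0 < η) :
    ∃ c₁ > (0 : ℝ), ∃ K > (0 : ℝ),
      ∀ (M : (n : ℕ) → Deanon.Model n) (γ ε : ℕ → ℝ) (δ : ℝ),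
        0 ≤ δ → δ ≤ 1 →
        (∀ᶠ n in atTop, (M n).β ≤ 1 - η) →
        (∀ᶠ n in atTop, Real.log (M n).α / Real.log (M n).β ≤ γ n) →
        (∀ᶠ n in atTop, 0 ≤ ε n ∧ ε n ≤ 1 ∧
          ε n ≤ c₁ * ((δ - δ ^ 2 / 2) * (M n).α * (1 - (M n).β) * (M n).s₁ * (M n).s₂ *
            Real.log (1 / (M n).α))) →
        (∃ c₀ > (0 : ℝ), (δ = 0 → K ≤ c₀) ∧
          ∀ᶠ n : ℕ in atTop,
            c₀ * (γ n * Real.log n ^ 2 / ((1 - δ / 2) * n)) ≤ (M n).density) →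
        Tendsto (fun n : ℕ => n * (M n).density) atTop atTop →
        Tendsto (fun n : ℕ => (M n).law.real ((M n).accurate (ε n * n ^ 2) ((1 - δ) * n)))
          atTop (𝓝 1) := by
  obtain ⟨h, hh0, hh1, hhη⟩ : ∃ h : ℝ, 0 < h ∧ h ≤ 1 ∧ h ≤ η :=
    ⟨min η 1, by positivity, min_le_right _ _, min_le_left _ _⟩
  -- `h ^ 2 / 4` is the factor in `mem_accurate`. The second constant makes `c = h ^ 3 * c₀ / 2048`
  -- at least `2` when `δ = 0`.
  refine ⟨h ^ 2 / 4, by positivity, 4096 / h ^ 3, by positivity, ?_⟩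
  rintro M γ ε δ hδ hδ1 hβ hγ hε ⟨c₀, hc₀, hK, hd⟩ hω
  set c := h ^ 3 / 512 * (c₀ / 4) with hc
  set c' := h / 512 * c₀ with hc'
  have hlim := ((Deanon.tendsto_sum_exp_pow_card (c := c) (δ := δ) (by positivity) hδ fun h0 => by
    have := hK h0
    rw [div_le_iff₀ (by positivity)] at this
    rw [hc]
    linarith).const_sub 1).sub (Deanon.tendsto_exp_mul_exp_sub_one (c := c') (by positivity))
  rw [sub_zero, sub_zero] at hlim
  refine tendsto_of_tendsto_of_tendsto_of_le_of_le' hlim tendsto_const_nhds ?_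
    (Eventually.of_forall fun n => measureReal_le_one)
  filter_upwards [hβ, hγ, hε, hd, hω.eventually_ge_atTop 1, eventually_ge_atTop 2]
    with n hβ hγ hε hd hω hn
  have hβ1 : (M n).β < 1 := by linarith
  have hα := (M n).α_pos (by omega)
  have hαβ := (M n).α_le_β (by omega)
  have hL := Deanon.log_one_div_pos hα (hαβ.trans_lt hβ1)
  have hs1 := (M n).s₁_pos
  have hs2 := (M n).s₂_pos
  obtain ⟨h1, h2⟩ := (M n).density_conditions hn hβ1 hc₀ hδ hδ1 hγ hd hω
  refine (M n).one_sub_le_law_real_accurate hn hα hh0 hh1 hδ (by linarith)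
    (fun e => ⟨(M n).α_le_pairProb e, (M n).pairProb_le_β e⟩) ?_ ?_ ?_
  · refine mul_le_mul_of_nonneg_right (hε.2.2.trans ?_) (by positivity)
    -- Only the bound by `δ` is needed from the factor `(δ - δ ^ 2 / 2) * (1 - β)`.
    have h3 : (δ - δ ^ 2 / 2) * (1 - (M n).β) ≤ δ * 1 := by
      have : 0 ≤ δ - δ ^ 2 / 2 := by nlinarith
      have : δ - δ ^ 2 / 2 ≤ δ := by nlinarith [sq_nonneg δ]
      gcongr
      linarith
    calc _ = h ^ 2 / 4 * ((δ - δ ^ 2 / 2) * (1 - (M n).β) *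
          ((M n).α * ((M n).s₁ * (M n).s₂) * Real.log (1 / (M n).α))) := by ring
      _ ≤ h ^ 2 / 4 * (δ * 1 *
          ((M n).α * ((M n).s₁ * (M n).s₂) * Real.log (1 / (M n).α))) := by gcongr
      _ = _ := by ring
  · have := mul_le_mul_of_nonneg_left h2 (show 0 ≤ h ^ 3 / 512 by positivity)
    rw [hc]
    linarith
  · have := mul_le_mul_of_nonneg_left h1 (show 0 ≤ h / 512 by positivity)
    rw [hc']
    linarith
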